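/- Let $k$ be an algebraically closed field of characteristic $0$. Let $R=k[X,Y,Z]$ act on $\mathcal D=k[x,y,z]$ by partial differentiation, with $X,Y,Z$ acting as $\partial/\partial x,\partial/\partial y,\partial/\partial z$; for a subspace $\mathcal W\subseteq\mathcal D_j$ let $\mathrm{Ann}_R(\mathcal W)$ be the ideal of all $F\in R$ that annihilate $\mathcal W$. A graded Artinian quotient $A=R/I=\bigoplus_{d\le j}A_d$ with $A_j\ne0$ and $I_0=I_1=0$ is a *level algebra* of codimension $3$ and socle degree $j$ if its socle $\{x\in A: xA_1=0\}$ equals $A_j$; its *type* is then $\dim_k A_j$. For integers $a\ge 4$, $i\ge 2a$ and $s\ge 1$ put $j=i+a$. Let $M(d)$ be the set of monomials of degree $d$ in three variables whose exponent in the first variable is at most $a-1$. Let $\mathcal E(C)=\langle f_1,\dots,f_s\rangle$, where $f_1,\dots,f_s$ are linear combinations of the monomials in $M(j)$ with coefficient vector $C$, and let $\mathcal F(C')=\langle g\rangle$, where $g\in\mathcal D_j$ is a form with coefficient vector $C'$. The triple $(a,i,s)$ is *permitted* if the matrix with rows indexed by the pairs $(E,n)$, $E\in M(j-i-3)$, $1\le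 n\le s$, and columns indexed by $D\in M(i+3)$, whose entries are the coefficients of the monomials $D$ in the partial derivatives $E*f_n$, has at least as many rows as columns, that is, if $s\cdot\#M(a-3)\ge\#M(i+3)$. For permitted $(a,i,s)$, the family $F_1(a,i,s)$ consists of the algebras $R/\mathrm{Ann}_R(\mathcal E(C)+\mathcal F(C'))$. It *has type* $t$ if for general $C$ and general $C'$ (that is, for $C$ and $C'$ in suitable dense Zariski-open subsets of their affine spaces) this algebra is a level algebra of codimension $3$, socle degree $j$ and type $t$. **Theorem.** (i) For fixed $a\ge4$ and $i\ge2a$, let $s=\left\lceil \frac{a(2i-a+9)}{a^2-3a+2}\right\rceil$. Then $(a,i,s)$ is permitted, $F_1(a,i,s)$ has type $1+s$, and $1+s$ is the smallest type of a family $F_1(a,i,s')$ with $(a,i,s')$ permitted. (ii) For fixed $a\ge4$, let $s=\left\lceil \frac{a(3a+9)}{a^2-3a+2}\right\rceil$. Then $(a,2a,s)$ is permitted, $F_1(a,2a,s)$ has type $1+s$, and $1+s$ is the smallest type of a family $F_1(a,i',s')$ with $(a,i',s')$ permitted. This smallest type is greater than $5$ if $a\le20$ and exactly $5$ if $a\ge21$.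 (iii) For every permitted $(a,i,s)$, the family $F_1(a,i,s)$ has a type, this type is unique, and it is at least $5$. -/

import Mathlib

open MvPolynomial

/-! ### Polynomials acting as differential operators -/

/-- The operator `∂^E = ∏ m, (∂/∂x_m)^(E m)` attached to the monomial `X^E`. -/
noncomputable def diffMonomial {r : ℕ} (A : Type*) [CommRing A] (E : Fin r →₀ ℕ) :
    Module.End A (MvPolynomial (Fin r) A) :=
  ((List.finRange r).map fun m => ((pderiv m).toLinearMap : Module.End A _) ^ E m).prod

/-- The action `F * f` of `R = k[X_1,…,X_r]` on `𝒟 = k[x_1,…,x_r]`: `X^E` acts as `∂^E`,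
extended by linearity in `F`. -/
noncomputable def diffAct {r : ℕ} (k : Type*) [Field k] :
    MvPolynomial (Fin r) k →ₗ[k] Module.End k (MvPolynomial (Fin r) k) :=
  (basisMonomials (Fin r) k).constr k fun E => diffMonomial k E

theorem commute_pderiv {r : ℕ} (A : Type*) [CommRing A] (m n : Fin r) :
    Commute ((pderiv m).toLinearMap : Module.End A (MvPolynomial (Fin r) A))
      ((pderiv n).toLinearMap : Module.End A (MvPolynomial (Fin r) A)) := by
  have h : ⁅(pderiv m : Derivation A (MvPolynomial (Fin r) A) (MvPolynomial (Fin r) A)),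
      (pderiv n : Derivation A (MvPolynomial (Fin r) A) (MvPolynomial (Fin r) A))⁆ = 0 := by
    apply MvPolynomial.derivation_ext
    intro i
    classical
    simp [Derivation.commutator_apply, pderiv_X, Pi.single_apply, apply_ite]
  refine LinearMap.ext fun f => ?_
  have := congrArg (fun d => d f) h
  simpa [Derivation.commutator_apply, sub_eq_zero] using this

theorem diffMonomial_add {r : ℕ} (A : Type*) [CommRing A] (E E' : Fin r →₀ ℕ) :
    diffMonomial A (E + E') = diffMonomial A E * diffMonomial A E' := by
  unfold diffMonomial
  induction List.finRange r with
  | nil => simp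
  | cons m l ih =>
    have hc : Commute (((l.map fun m => ((pderiv m).toLinearMap :
        Module.End A (MvPolynomial (Fin r) A)) ^ E m)).prod)
        (((pderiv m).toLinearMap : Module.End A (MvPolynomial (Fin r) A)) ^ E' m) := by
      refine Commute.list_prod_left _ _ fun x hx => ?_
      obtain ⟨n, -, rfl⟩ := List.mem_map.1 hx
      exact (commute_pderiv A n m).pow_pow _ _
    simp only [List.map_cons, List.prod_cons]
    rw [ih, Finsupp.add_apply, pow_add, mul_assoc, mul_assoc, ← mul_assoc (_ ^ E' m), ← hc.eq,
      mul_assoc]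

theorem diffAct_mul {r : ℕ} (k : Type*) [Field k] (F G : MvPolynomial (Fin r) k) :
    diffAct k (F * G) = diffAct k F * diffAct k G := by
  have hm : ∀ E : Fin r →₀ ℕ, diffAct k (monomial E (1 : k)) = diffMonomial k E := fun E => by
    have := (basisMonomials (Fin r) k).constr_basis k (fun E => diffMonomial k E) E
    simpa [diffAct] using this
  have hm' : ∀ (E : Fin r →₀ ℕ) (c : k),
      diffAct k (monomial E c) = c • diffMonomial k E := fun E c => by
    rw [← hm, ← map_smul, smul_monomial, smul_eq_mul, mul_one]
  induction F using MvPolynomial.induction_on' with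
  | add p q hp hq => rw [add_mul, map_add, hp, hq, map_add, add_mul]
  | monomial E c =>
    induction G using MvPolynomial.induction_on' with
    | add p q hp hq => rw [mul_add, map_add, hp, hq, map_add, mul_add]
    | monomial E' c' =>
      rw [monomial_mul, hm', hm', hm', diffMonomial_add, smul_mul_smul_comm]

/-- `Ann_R(𝒲)`, the ideal of all `F ∈ R` with `F * f = 0` for every `f ∈ 𝒲`. -/
noncomputable def annIdeal {r : ℕ} {k : Type*} [Field k]
    (W : Submodule k (MvPolynomial (Fin r) k)) : Ideal (MvPolynomial (Fin r) k) where
  carrier := {F | ∀ f ∈ W, diffAct k F f = 0}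
  add_mem' hF hG f hf := by simp [hF f hf, hG f hf]
  zero_mem' f _ := by simp
  smul_mem' G F hF f hf := by simp [diffAct_mul, hF f hf]

/-! ### Level algebras -/

/-- The graded piece `A_d` of `A = R/I`: the image of the forms of degree `d`. -/
noncomputable def gradedPiece {r : ℕ} {k : Type*} [Field k]
    (I : Ideal (MvPolynomial (Fin r) k)) (d : ℕ) : Submodule k (MvPolynomial (Fin r) k ⧸ I) :=
  (homogeneousSubmodule (Fin r) k d).map (Ideal.Quotient.mkₐ k I).toLinearMap

/-- The socle `{x ∈ A | x A_1 = 0}` of `A = R/I`. -/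
noncomputable def socle {r : ℕ} {k : Type*} [Field k]
    (I : Ideal (MvPolynomial (Fin r) k)) : Submodule k (MvPolynomial (Fin r) k ⧸ I) where
  carrier := {x | ∀ l ∈ gradedPiece I 1, x * l = 0}
  add_mem' hx hy l hl := by rw [add_mul, hx l hl, hy l hl, add_zero]
  zero_mem' l _ := zero_mul l
  smul_mem' c x hx l hl := by rw [smul_mul_assoc, hx l hl, smul_zero]

/-- `R/I` is a graded Artinian level algebra of codimension `r` (the number of variables),
socle degree `j` and type `t`. -/
structure IsLevelAlgebra {r : ℕ} {k : Type*} [Field k]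
    (I : Ideal (MvPolynomial (Fin r) k)) (j t : ℕ) : Prop where
  homogeneous : ∀ F ∈ I, ∀ d : ℕ, homogeneousComponent d F ∈ I
  /-- `I` contains no nonzero forms of degree `0` or `1`. -/
  codim : ∀ d ≤ 1, ∀ F ∈ I, F.IsHomogeneous d → F = 0
  artinian : Module.Finite k (MvPolynomial (Fin r) k ⧸ I)
  top_ne_bot : gradedPiece I j ≠ ⊥
  eq_bot_of_lt : ∀ d, j < d → gradedPiece I d = ⊥
  level : gradedPiece I j = socle I
  type_eq : Module.finrank k (gradedPiece I j) = t

/-! ### "For general `C`" -/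

/-- Zariski-open subsets of the affine space `k^ι`. -/
def IsZariskiOpen {k ι : Type*} [Field k] (U : Set (ι → k)) : Prop :=
  ∃ S : Set (MvPolynomial ι k), U = {C | ∃ p ∈ S, eval C p ≠ 0}

/-- Zariski-dense subsets of `k^ι`: they meet every nonempty Zariski-open set. -/
def IsZariskiDense {k ι : Type*} [Field k] (U : Set (ι → k)) : Prop :=
  ∀ V : Set (ι → k), IsZariskiOpen V → V.Nonempty → (U ∩ V).Nonempty

/-- `p C C'` holds for general `C ∈ k^ι` and general `C' ∈ k^κ`. -/
def ForGeneral₂ {k ι κ : Type*} [Field k] (p : (ι → k) → (κ → k) → Prop) : Prop :=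
  ∃ (U : Set (ι → k)) (U' : Set (κ → k)),
    IsZariskiOpen U ∧ IsZariskiDense U ∧ IsZariskiOpen U' ∧ IsZariskiDense U' ∧
      ∀ C ∈ U, ∀ C' ∈ U', p C C'

/-! ### Constrained monomials and the families they span -/

/-- `ℳ_K(d)`: the multi-indexes `D` of dimension `r` and degree `d` constrained by
`K = (K_1,…,K_n)`, that is, with `D_m ≤ K_m` for `m = 1,…,n`. -/
def constrained (r : ℕ) (K : List ℕ) (d : ℕ) : Finset (Fin r →₀ ℕ) :=
  {D ∈ Finset.univ.finsuppAntidiag d | ∀ m : Fin r, ∀ h : (m : ℕ) < K.length, D m ≤ K[(m : ℕ)]}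

/-- The generic form `f_n = ∑ z_{nJ} x^J`, `J ∈ ℳ_K(j)`, with indeterminate coefficients. -/
noncomputable def genericForm (k : Type*) [Field k] (r : ℕ) (K : List ℕ) (j s : ℕ) (n : Fin s) :
    MvPolynomial (Fin r) (MvPolynomial (Fin s × constrained r K j) k) :=
  ∑ J : constrained r K j, monomial J.1 (X (n, J))

/-- The subspace `⟨f_1(C),…,f_s(C)⟩ ⊆ 𝒟_j` obtained by substituting `C` for the
indeterminate coefficients. -/
noncomputable def formSpan {k : Type*} [Field k] (r : ℕ) (K : List ℕ) (j s : ℕ)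
    (C : Fin s × constrained r K j → k) : Submodule k (MvPolynomial (Fin r) k) :=
  Submodule.span k (Set.range fun n => MvPolynomial.map (eval C) (genericForm k r K j s n))

/-- The `e`-th cropped matrix of the family `⟨f_1,…,f_s⟩`: its rows are indexed by the pairs
`(E, n)` with `E ∈ ℳ_K(e)`, its columns by `D ∈ ℳ_K(j - e)`, and the entry is the coefficient
of `x^D` in `X^E * f_n`. -/
noncomputable def croppedMatrix (k : Type*) [Field k] (r : ℕ) (K : List ℕ) (j s e : ℕ) :
    Matrix (constrained r K e × Fin s) (constrained r K (j - e))
      (MvPolynomial (Fin s × constrained r K j) k) :=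
  fun En D => coeff D.1 (diffMonomial _ En.1.1 (genericForm k r K j s En.2))

/-- The matrix has at least as many rows as columns. -/
def Matrix.RowsGeCols {m n α : Type*} [Fintype m] [Fintype n] (_ : Matrix m n α) : Prop :=
  Fintype.card n ≤ Fintype.card m

/-! ### The family `F₁(a, i, s)` -/

/-- The parameters `a, i, s` are permitted: `a ≥ 4`, `i ≥ 2a`, `s` is a positive integer, and
with `j = i + a`, `P = (a - 1)` and final degree `i + 3`, the `(j - (i + 3))`-th cropped matrix
of `ℰ` has at least as many rows as columns. -/
def F1Permitted (k : Type*) [Field k] (a i s : ℕ) : Prop :=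
  4 ≤ a ∧ 2 * a ≤ i ∧ 0 < s ∧
    (croppedMatrix k 3 [a - 1] (i + a) s (i + a - (i + 3))).RowsGeCols

/-- The ideal `Ann_R(ℰ(C) + ℱ(C'))`, where `r = 3`, `j = i + a`, `ℰ(C)` is spanned by `s` forms
of degree `j` constrained by `P = (a - 1)`, and `ℱ(C')` by one form of degree `j` constrained by
`Q = (j, j, j)`. -/
noncomputable def F1Ideal {k : Type*} [Field k] (a i s : ℕ)
    (C : Fin s × constrained 3 [a - 1] (i + a) → k)
    (C' : Fin 1 × constrained 3 [i + a, i + a, i + a] (i + a) → k) :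
    Ideal (MvPolynomial (Fin 3) k) :=
  annIdeal (formSpan 3 [a - 1] (i + a) s C ⊔ formSpan 3 [i + a, i + a, i + a] (i + a) 1 C')

/-- The parameters are permitted and the family `F₁(a, i, s)` has type `t`: for general `C` and
`C'` the algebra `R/Ann_R(ℰ(C) + ℱ(C'))` is a level algebra of codimension `3`, socle degree
`i + a` and type `t`. -/
def F1HasType (k : Type*) [Field k] (a i s t : ℕ) : Prop :=
  F1Permitted k a i s ∧
    ForGeneral₂ fun C C' => IsLevelAlgebra (F1Ideal (k := k) a i s C C') (i + a) t

/-! By Macaulay duality in characteristic `0`, any nonzero finite-dimensional `W ⊆ 𝒟_j` gives a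
level algebra `R/Ann(W)` of socle degree `j` and type `dim W`; its codimension is `r` as soon as no
nonzero linear form kills `W` (`isLevelAlgebra_annIdeal`). So the type of `F₁(a, i, s)` is the
generic dimension of `ℰ(C) + ℱ(C')`. A general coefficient matrix has full rank
(`exists_rank_eq_min`). A general `g` is killed by no nonzero linear form and contains `x^j`, which
no form in `ℰ(C)` does (`exists_nondegenerate`). Hence the sum is direct and the type is `1 + min(s,
#M(j))`.

The rest is counting. Since `2 #M(i+3) = a(2i+9-a)` and `2 #M(a-3) = (a-1)(a-2)`, the least
permitted `s` is the stated ceiling. It does not exceed `#M(j)`, so the minimum never pushes the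
type below `1 + ⌈…⌉`. The ceiling grows with `i`, which singles out `i = 2a`. It is always at least
`4`, and at `i = 2a` it equals `4` exactly when `a² - 21a + 8 ≥ 0`, that is, when `a ≥ 21`. -/

/-! ### Coefficients of the differential action. -/

theorem diffMonomial_single {r : ℕ} (A : Type*) [CommRing A] (m : Fin r) (n : ℕ) :
    diffMonomial A (Finsupp.single m n) =
      ((pderiv m).toLinearMap : Module.End A (MvPolynomial (Fin r) A)) ^ n := by
  unfold diffMonomial
  rw [List.prod_map_eq_pow_single m _ fun m' hm' _ => by
    rw [Finsupp.single_eq_of_ne hm', pow_zero]]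
  rw [List.count_eq_one_of_mem (List.nodup_finRange r) (List.mem_finRange m), pow_one,
    Finsupp.single_eq_same]

/-- The factor is a product of rising integer factors, one for each derivative taken. Only its being
a nonzero natural number matters: in characteristic `0` it can be divided out. -/
theorem exists_coeff_diffMonomial {r : ℕ} (A : Type*) [CommRing A] (E : Fin r →₀ ℕ) :
    ∃ c : (Fin r →₀ ℕ) → ℕ, (∀ D, c D ≠ 0) ∧ ∀ (f : MvPolynomial (Fin r) A) D,
      coeff D (diffMonomial A E f) = c D * coeff (D + E) f := by
  have hzero : ∃ c : (Fin r →₀ ℕ) → ℕ, (∀ D, c D ≠ 0) ∧ ∀ (f : MvPolynomial (Fin r) A) D,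
      coeff D (diffMonomial A 0 f) = c D * coeff (D + 0) f :=
    ⟨fun _ => 1, by simp, fun f D => by simp [diffMonomial, Module.End.one_apply]⟩
  have hadd : ∀ E E' : Fin r →₀ ℕ,
      (∃ c : (Fin r →₀ ℕ) → ℕ, (∀ D, c D ≠ 0) ∧ ∀ (f : MvPolynomial (Fin r) A) D,
        coeff D (diffMonomial A E f) = c D * coeff (D + E) f) →
      (∃ c : (Fin r →₀ ℕ) → ℕ, (∀ D, c D ≠ 0) ∧ ∀ (f : MvPolynomial (Fin r) A) D,
        coeff D (diffMonomial A E' f) = c D * coeff (D + E') f) →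
      ∃ c : (Fin r →₀ ℕ) → ℕ, (∀ D, c D ≠ 0) ∧ ∀ (f : MvPolynomial (Fin r) A) D,
        coeff D (diffMonomial A (E + E') f) = c D * coeff (D + (E + E')) f := by
    rintro E E' ⟨c, hc, h⟩ ⟨c', hc', h'⟩
    refine ⟨fun D => c D * c' (D + E), fun D => mul_ne_zero (hc _) (hc' _), fun f D => ?_⟩
    rw [diffMonomial_add, Module.End.mul_apply, h, h', add_assoc]
    push_cast
    ring
  induction E using Finsupp.induction_linear with
  | zero => exact hzero
  | add E E' h h' => exact hadd E E' h h'
  | single m n =>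
    induction n with
    | zero => simpa using hzero
    | succ n ih =>
      rw [Finsupp.single_add]
      refine hadd _ _ ih ⟨fun D => D m + 1, by simp, fun f D => ?_⟩
      rw [diffMonomial_single, pow_one, Derivation.coeFn_coe, coeff_pderiv]
      push_cast
      ring

theorem diffAct_monomial {r : ℕ} (k : Type*) [Field k] (E : Fin r →₀ ℕ) (c : k) :
    diffAct k (monomial E c) = c • diffMonomial k E := by
  have h := (basisMonomials (Fin r) k).constr_basis k (fun E => diffMonomial k E) E
  rw [← mul_one c, ← smul_eq_mul, ← smul_monomial, map_smul, smul_eq_mul, mul_one]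
  exact congrArg (c • ·) h

theorem exists_coeff_diffAct (k : Type*) [Field k] (r : ℕ) :
    ∃ c : (Fin r →₀ ℕ) → (Fin r →₀ ℕ) → ℕ, (∀ E D, c E D ≠ 0) ∧
      ∀ (F f : MvPolynomial (Fin r) k) D,
        coeff D (diffAct k F f) = ∑ E ∈ F.support, coeff E F * (c E D * coeff (D + E) f) := by
  choose c hc h using exists_coeff_diffMonomial (r := r) k
  refine ⟨c, hc, fun F f D => ?_⟩
  conv_lhs => rw [F.as_sum]
  rw [map_sum, LinearMap.sum_apply, coeff_sum]
  refine Finset.sum_congr rfl fun E _ => ?_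
  rw [diffAct_monomial, LinearMap.smul_apply, coeff_smul, h, smul_eq_mul]

theorem coeff_diffAct_eq_zero {r j d : ℕ} {k : Type*} [Field k] {F f : MvPolynomial (Fin r) k}
    (hF : F.IsHomogeneous d) (hf : f.IsHomogeneous j) {D : Fin r →₀ ℕ} (hD : D.degree + d ≠ j) :
    coeff D (diffAct k F f) = 0 := by
  obtain ⟨c, -, h⟩ := exists_coeff_diffAct k r
  rw [h]
  refine Finset.sum_eq_zero fun E hE => ?_
  have hEd : E.degree = d := by
    by_contra hne
    exact mem_support_iff.1 hE (hF.coeff_eq_zero hne)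
  rw [hf.coeff_eq_zero (by rwa [map_add, hEd]), mul_zero, mul_zero]

theorem coeff_diffAct_homogeneousComponent {r j d : ℕ} {k : Type*} [Field k]
    (F : MvPolynomial (Fin r) k) {f : MvPolynomial (Fin r) k} (hf : f.IsHomogeneous j)
    {D : Fin r →₀ ℕ} (hD : D.degree + d = j) :
    coeff D (diffAct k (homogeneousComponent d F) f) = coeff D (diffAct k F f) := by
  conv_rhs => rw [← sum_homogeneousComponent F]
  rw [map_sum, LinearMap.sum_apply, coeff_sum]
  rw [Finset.sum_eq_single d]
  · intro e _ he
    exact coeff_diffAct_eq_zero (homogeneousComponent_isHomogeneous e F) hf (by omega)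
  · intro hd
    rw [homogeneousComponent_eq_zero d F (by simpa using hd), map_zero, LinearMap.zero_apply,
      coeff_zero]

theorem coeff_diffAct_X {r : ℕ} {k : Type*} [Field k] (m : Fin r) (f : MvPolynomial (Fin r) k)
    (D : Fin r →₀ ℕ) :
    coeff D (diffAct k (X m) f) = coeff (D + Finsupp.single m 1) f * (D m + 1) := by
  rw [X, diffAct_monomial, one_smul, diffMonomial_single, pow_one,
    Derivation.coeFn_coe, coeff_pderiv]

/-! ### Macaulay duality: annihilators of spaces of forms. -/

section annIdeal

variable {r j : ℕ} {k : Type*} [Field k] {W : Submodule k (MvPolynomial (Fin r) k)}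

theorem mem_annIdeal {F : MvPolynomial (Fin r) k} :
    F ∈ annIdeal W ↔ ∀ f ∈ W, diffAct k F f = 0 := Iff.rfl

theorem mem_annIdeal_of_isHomogeneous (hW : W ≤ homogeneousSubmodule (Fin r) k j) {d : ℕ}
    {F : MvPolynomial (Fin r) k} (hF : F.IsHomogeneous d) (hd : j < d) : F ∈ annIdeal W := by
  intro f hf
  ext D
  exact coeff_diffAct_eq_zero hF (hW hf) (by omega)

theorem homogeneousComponent_mem_annIdeal (hW : W ≤ homogeneousSubmodule (Fin r) k j)
    {F : MvPolynomial (Fin r) k} (hF : F ∈ annIdeal W) (d : ℕ) :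
    homogeneousComponent d F ∈ annIdeal W := by
  intro f hf
  ext D
  by_cases hD : D.degree + d = j
  · rw [coeff_diffAct_homogeneousComponent F (hW hf) hD, hF f hf]
  · exact coeff_diffAct_eq_zero (homogeneousComponent_isHomogeneous d F) (hW hf) hD

/-- Modulo the annihilator, a polynomial equals its truncation to degrees at most `j`. -/
theorem finite_quotient_annIdeal (hW : W ≤ homogeneousSubmodule (Fin r) k j) :
    Module.Finite k (MvPolynomial (Fin r) k ⧸ annIdeal W) := by
  refine Module.Finite.of_surjective
    ((Ideal.Quotient.mkₐ k (annIdeal W)).toLinearMap ∘ₗ (restrictTotalDegree (Fin r) k j).subtype)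
    fun x => ?_
  obtain ⟨F, rfl⟩ := Ideal.Quotient.mk_surjective x
  refine ⟨⟨∑ d ∈ Finset.range (j + 1), homogeneousComponent d F, Submodule.sum_mem _ fun d hd => ?_⟩,
    ?_⟩
  · rw [mem_restrictTotalDegree]
    exact (homogeneousComponent_isHomogeneous d F).totalDegree_le.trans
      (Nat.lt_succ_iff.1 (Finset.mem_range.1 hd))
  · refine Ideal.Quotient.eq.2 fun f hf => ?_
    ext D
    rw [Submodule.subtype_apply, map_sub, map_sum, LinearMap.sub_apply, LinearMap.sum_apply, coeff_sub, coeff_sum, coeff_zero,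
      sub_eq_zero]
    by_cases hD : D.degree ≤ j
    · rw [Finset.sum_eq_single (j - D.degree)]
      · exact coeff_diffAct_homogeneousComponent F (hW hf) (by omega)
      · intro e _ he
        exact coeff_diffAct_eq_zero (homogeneousComponent_isHomogeneous e F) (hW hf) (by omega)
      · intro h
        exact absurd (Finset.mem_range.2 (by omega)) h
    · rw [Finset.sum_eq_zero fun e _ => coeff_diffAct_eq_zero
        (homogeneousComponent_isHomogeneous e F) (hW hf) (by omega)]
      conv_rhs => rw [← sum_homogeneousComponent F]
      rw [map_sum, LinearMap.sum_apply, coeff_sum]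
      exact (Finset.sum_eq_zero fun e _ => coeff_diffAct_eq_zero
        (homogeneousComponent_isHomogeneous e F) (hW hf) (by omega)).symm

/-- The apolarity pairing of the forms of degree `j` with `W ⊆ 𝒟_j`. -/
noncomputable def apolarity (j : ℕ) (W : Submodule k (MvPolynomial (Fin r) k)) :
    homogeneousSubmodule (Fin r) k j →ₗ[k] Module.Dual k W :=
  LinearMap.mk₂ k (fun F f => coeff 0 (diffAct k F.1 f.1)) (by simp) (by simp) (by simp) (by simp)

theorem apolarity_apply (F : homogeneousSubmodule (Fin r) k j) (f : W) :
    apolarity j W F f = coeff 0 (diffAct k F.1 f.1) := rfl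

/-- Monomials of degree `j` are dual to each other up to the nonzero integers `c E 0`. A functional
on `W` is extended to all polynomials and its values on monomials, divided by these integers, are
the coefficients of `F`. -/
theorem apolarity_surjective [CharZero k] (hW : W ≤ homogeneousSubmodule (Fin r) k j) :
    Function.Surjective (apolarity j W) := by
  intro φ
  obtain ⟨ψ, hψ⟩ := LinearMap.exists_extend φ
  obtain ⟨c, hc, h⟩ := exists_coeff_diffAct k r
  classical
  set T : Finset (Fin r →₀ ℕ) := Finset.univ.finsuppAntidiag j with hT
  have hmem : ∀ E : Fin r →₀ ℕ, E ∈ T ↔ E.degree = j := fun E => by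
    rw [hT, Finset.mem_finsuppAntidiag, Finsupp.degree_eq_sum]
    simp
  set F : MvPolynomial (Fin r) k := ∑ E ∈ T, monomial E (ψ (monomial E 1) / c E 0) with hF
  have hFh : F.IsHomogeneous j := IsHomogeneous.sum _ _ _ fun E hE =>
    isHomogeneous_monomial _ ((hmem E).1 hE)
  refine ⟨⟨F, hFh⟩, LinearMap.ext fun f => ?_⟩
  have hsupp : f.1.support ⊆ T := fun E hE => (hmem E).2 <| by
    by_contra hne
    exact mem_support_iff.1 hE ((hW f.2).coeff_eq_zero hne)
  rw [apolarity_apply, ← hψ, LinearMap.comp_apply, Submodule.subtype_apply]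
  simp only [hF, map_sum, LinearMap.sum_apply, coeff_sum]
  conv_rhs => rw [f.1.as_sum, map_sum]
  rw [Finset.sum_subset hsupp fun E _ hE => by
    rw [notMem_support_iff.1 hE, monomial_zero, map_zero]]
  refine Finset.sum_congr rfl fun E _ => ?_
  have hcE : (c E 0 : k) ≠ 0 := Nat.cast_ne_zero.2 (hc E 0)
  have hmon : monomial E (coeff E f.1) = coeff E f.1 • monomial E (1 : k) := by
    rw [smul_monomial, smul_eq_mul, mul_one]
  rw [hmon, map_smul, smul_eq_mul, h,
    Finset.sum_subset (support_monomial_subset (s := E)) fun E' _ hE' => by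
      rw [notMem_support_iff.1 hE', zero_mul],
    Finset.sum_singleton, coeff_monomial, if_pos rfl, zero_add]
  field_simp

theorem apolarity_eq_zero_iff (hW : W ≤ homogeneousSubmodule (Fin r) k j)
    (F : homogeneousSubmodule (Fin r) k j) : apolarity j W F = 0 ↔ F.1 ∈ annIdeal W := by
  refine ⟨fun h f hf => ?_, fun h => LinearMap.ext fun f => ?_⟩
  · ext D
    by_cases hD : D = 0
    · subst hD
      exact LinearMap.congr_fun h ⟨f, hf⟩
    · refine coeff_diffAct_eq_zero F.2 (hW hf) ?_
      rw [Ne, Nat.add_eq_right, Finsupp.degree_eq_zero_iff]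
      exact hD
  · rw [apolarity_apply, h f.1 f.2]
    rfl

/-- The kernel of the apolarity pairing is the degree-`j` part of the annihilator, so `A_j` is the
dual of `W`. -/
theorem finrank_gradedPiece_annIdeal [CharZero k] (hW : W ≤ homogeneousSubmodule (Fin r) k j) :
    Module.finrank k (gradedPiece (annIdeal W) j) = Module.finrank k W := by
  set q := (Ideal.Quotient.mkₐ k (annIdeal W)).toLinearMap ∘ₗ
    (homogeneousSubmodule (Fin r) k j).subtype with hq
  have hker : LinearMap.ker q = LinearMap.ker (apolarity j W) := by
    ext F
    rw [LinearMap.mem_ker, LinearMap.mem_ker, apolarity_eq_zero_iff hW]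
    exact Ideal.Quotient.eq_zero_iff_mem
  have hr : gradedPiece (annIdeal W) j = LinearMap.range q := by
    rw [hq, LinearMap.range_comp, Submodule.range_subtype, gradedPiece]
  rw [hr, ← (LinearMap.quotKerEquivRange q).finrank_eq, hker,
    ((apolarity j W).quotKerEquivOfSurjective (apolarity_surjective hW)).finrank_eq,
    Subspace.dual_finrank_eq]

/-- If every `X_m F` annihilates `W`, then all first partials of `F * f` vanish. In characteristic
`0` this makes `F * f` constant, and only the degree-`j` component of `F` contributes to the
constant term. -/
theorem gradedPiece_eq_socle_annIdeal [CharZero k] (hW : W ≤ homogeneousSubmodule (Fin r) k j) :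
    gradedPiece (annIdeal W) j = socle (annIdeal W) := by
  apply le_antisymm
  · rintro _ ⟨F, hF, rfl⟩ _ ⟨L, hL, rfl⟩
    exact Ideal.Quotient.eq_zero_iff_mem.2
      (mem_annIdeal_of_isHomogeneous hW (hF.mul hL) (Nat.lt_succ_self j))
  · intro x hx
    obtain ⟨F, rfl⟩ := Ideal.Quotient.mk_surjective x
    refine ⟨homogeneousComponent j F, homogeneousComponent_isHomogeneous j F, ?_⟩
    refine Ideal.Quotient.eq.2 fun f hf => ?_
    ext D
    rw [map_sub, LinearMap.sub_apply, coeff_sub, coeff_zero, sub_eq_zero]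
    by_cases hD : D = 0
    · subst hD
      exact coeff_diffAct_homogeneousComponent F (hW hf) (by simp)
    -- Some `x_m` divides `x^D`; the coefficient of `x^D / x_m` in `X_m * (F * f) = 0` is a nonzero
    -- integer times the coefficient at `D`.
    · obtain ⟨m, hm⟩ := Finsupp.ne_iff.1 hD
      rw [coeff_diffAct_eq_zero (homogeneousComponent_isHomogeneous j F) (hW hf)
        (by rwa [Ne, Nat.add_eq_right, Finsupp.degree_eq_zero_iff])]
      have hFm : F * X m ∈ annIdeal W :=
        Ideal.Quotient.eq_zero_iff_mem.1 (hx _ ⟨X m, isHomogeneous_X k m, rfl⟩)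
      have h0 := congrArg (coeff (D - Finsupp.single m 1)) (hFm f hf)
      rw [mul_comm, diffAct_mul, Module.End.mul_apply, coeff_diffAct_X, coeff_zero,
        tsub_add_cancel_of_le
          (Finsupp.single_le_iff.2 (Nat.one_le_iff_ne_zero.2 hm))] at h0
      exact ((mul_eq_zero.1 h0).resolve_right (Nat.cast_add_one_ne_zero _)).symm

theorem isLevelAlgebra_annIdeal [CharZero k] (hW : W ≤ homogeneousSubmodule (Fin r) k j)
    (hpos : Module.finrank k W ≠ 0)
    (hcodim : ∀ d ≤ 1, ∀ F ∈ annIdeal W, F.IsHomogeneous d → F = 0) :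
    IsLevelAlgebra (annIdeal W) j (Module.finrank k W) where
  homogeneous F hF d := homogeneousComponent_mem_annIdeal hW hF d
  codim := hcodim
  artinian := finite_quotient_annIdeal hW
  top_ne_bot h := hpos (by rw [← finrank_gradedPiece_annIdeal hW, h, finrank_bot])
  eq_bot_of_lt d hd := by
    rw [eq_bot_iff]
    rintro _ ⟨F, hF, rfl⟩
    exact Ideal.Quotient.eq_zero_iff_mem.2 (mem_annIdeal_of_isHomogeneous hW hF hd)
  level := gradedPiece_eq_socle_annIdeal hW
  type_eq := finrank_gradedPiece_annIdeal hW

end annIdeal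

/-! ### Counting constrained monomials. -/

/-- Monomials are sorted by the exponent `e` of the first variable. Truncated subtraction gives the
correct count `0` when `e > d`. -/
theorem card_constrained_three (b d : ℕ) :
    (constrained 3 [b] d).card = ∑ e ∈ Finset.range (b + 1), (d + 1 - e) := by
  have hmem : ∀ D : Fin 3 →₀ ℕ, D ∈ constrained 3 [b] d ↔ D 0 + D 1 + D 2 = d ∧ D 0 ≤ b := by
    intro D
    simp [constrained, Finset.mem_finsuppAntidiag, Fin.sum_univ_three]
  have h : (constrained 3 [b] d).card =
      ((Finset.range (b + 1)).sigma fun e => Finset.range (d + 1 - e)).card := by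
    refine Finset.card_bij' (fun D _ => ⟨D 0, D 1⟩)
      (fun p _ => Finsupp.equivFunOnFinite.symm ![p.1, p.2, d - p.1 - p.2]) ?_ ?_ ?_ ?_
    · intro D hD
      rw [hmem] at hD
      simp only [Finset.mem_sigma, Finset.mem_range]
      omega
    · intro p hp
      simp only [Finset.mem_sigma, Finset.mem_range] at hp
      rw [hmem]
      constructor
      · simp
        omega
      · simp
        omega
    · intro D hD
      rw [hmem] at hD
      ext m
      fin_cases m <;> simp <;> omega
    · intro p _
      simp
  rw [h, Finset.card_sigma]
  simp

/-- An arithmetic progression; the closed form survives one truncated term, `e = d + 1`, whose value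
is `0` anyway. -/
theorem two_mul_sum_range_tsub {n d : ℕ} (h : n ≤ d + 2) :
    (2 * ∑ e ∈ Finset.range n, (d + 1 - e) : ℕ) = n * (2 * d + 3 - n) := by
  induction n with
  | zero => simp
  | succ n ih =>
    rw [Finset.sum_range_succ, mul_add, ih (by omega)]
    obtain ⟨m, hdm⟩ : ∃ m, d + 1 = n + m := ⟨d + 1 - n, by omega⟩
    obtain rfl | hm := Nat.eq_zero_or_pos m
    · have h1 : 2 * d + 3 - n = n + 1 := by omega
      have h2 : 2 * d + 3 - (n + 1) = n := by omega
      have h3 : d + 1 - n = 0 := by omega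
      rw [h1, h2, h3]
      ring
    · have h1 : 2 * d + 3 - n = n + 2 * m + 1 := by omega
      have h2 : 2 * d + 3 - (n + 1) = n + 2 * m := by omega
      have h3 : d + 1 - n = m := by omega
      rw [h1, h2, h3]
      ring

theorem two_mul_card_constrained_three {b d : ℕ} (h : b ≤ d + 1) :
    2 * (constrained 3 [b] d).card = (b + 1) * (2 * d + 2 - b) := by
  rw [card_constrained_three, two_mul_sum_range_tsub (by omega)]
  congr 1
  omega

theorem F1Permitted_iff (k : Type*) [Field k] (a i s : ℕ) :
    F1Permitted k a i s ↔ 4 ≤ a ∧ 2 * a ≤ i ∧ 0 < s ∧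
      a * (2 * i + 9 - a) ≤ s * ((a - 1) * (a - 2)) := by
  unfold F1Permitted Matrix.RowsGeCols
  refine and_congr_right fun ha => and_congr_right fun hi => and_congr_right fun _ => ?_
  rw [Fintype.card_prod, Fintype.card_coe, Fintype.card_coe, Fintype.card_fin]
  have h1 : i + a - (i + 3) = a - 3 := by omega
  have h2 : i + a - (a - 3) = i + 3 := by omega
  rw [h1, h2]
  have hcol : 2 * (constrained 3 [a - 1] (i + 3)).card = a * (2 * i + 9 - a) := by
    rw [two_mul_card_constrained_three (by omega)]
    congr 1 <;> omega
  have hrow : 2 * (constrained 3 [a - 1] (a - 3)).card = (a - 1) * (a - 2) := by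
    -- Here the bound `a - 1` exceeds the degree `a - 3`, so the sum runs one term past the range of
    -- the closed form; that last term is zero and is split off.
    obtain ⟨d, rfl⟩ : ∃ d, a = d + 3 := ⟨a - 3, by omega⟩
    rw [card_constrained_three, show d + 3 - 1 + 1 = d + 2 + 1 by omega,
      Finset.sum_range_succ, mul_add, two_mul_sum_range_tsub (by omega)]
    have h1 : d + 3 - 3 = d := by omega
    have h2 : d + 3 - 1 = d + 2 := by omega
    have h3 : d + 3 - 2 = d + 1 := by omega
    have h4 : 2 * d + 3 - (d + 2) = d + 1 := by omega
    have h5 : d + 1 - (d + 2) = 0 := by omega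
    rw [h1, h2, h3, h4, h5, mul_zero, add_zero]
  rw [← hcol, ← hrow]
  constructor <;> intro h <;> nlinarith

/-- The ceiling is the least `s` satisfying the inequality of `F1Permitted_iff`. -/
theorem ceil_le_iff_rows {a i s : ℕ} (ha : 4 ≤ a) (hi : 2 * a ≤ i) :
    ⌈((a : ℚ) * (2 * i - a + 9)) / ((a : ℚ) ^ 2 - 3 * a + 2)⌉₊ ≤ s ↔
      a * (2 * i + 9 - a) ≤ s * ((a - 1) * (a - 2)) := by
  have hpos : (0 : ℚ) < (a : ℚ) ^ 2 - 3 * a + 2 := by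
    have : (4 : ℚ) ≤ a := by exact_mod_cast ha
    nlinarith
  rw [Nat.ceil_le, div_le_iff₀ hpos, ← Nat.cast_le (α := ℚ)]
  push_cast [Nat.cast_sub (show a ≤ 2 * i + 9 by omega), Nat.cast_sub (show 1 ≤ a by omega),
    Nat.cast_sub (show 2 ≤ a by omega)]
  rw [show (a : ℚ) * (2 * i - a + 9) = a * (2 * i + 9 - a) by ring,
    show (s : ℚ) * ((a : ℚ) ^ 2 - 3 * a + 2) = s * ((a - 1) * (a - 2)) by ring]

/-! ### Generic points and generic rank. -/

section Zariski

variable {k ι κ : Type*} [Field k]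

theorem isZariskiOpen_eval_ne_zero (p : MvPolynomial ι k) :
    IsZariskiOpen {C : ι → k | eval C p ≠ 0} :=
  ⟨{p}, by simp⟩

theorem exists_eval_ne_zero [Infinite k] {p : MvPolynomial ι k} (hp : p ≠ 0) :
    ∃ C : ι → k, eval C p ≠ 0 := by
  by_contra! h
  exact hp (MvPolynomial.funext fun C => by rw [h C, map_zero])

theorem isZariskiDense_eval_ne_zero [Infinite k] {p : MvPolynomial ι k} (hp : p ≠ 0) :
    IsZariskiDense {C : ι → k | eval C p ≠ 0} := by
  rintro _ ⟨S, rfl⟩ ⟨C, q, hqS, hq⟩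
  have hq0 : q ≠ 0 := by
    rintro rfl
    exact hq (map_zero _)
  obtain ⟨C', hC'⟩ := exists_eval_ne_zero (mul_ne_zero hp hq0)
  rw [map_mul] at hC'
  exact ⟨C', left_ne_zero_of_mul hC', q, hqS, right_ne_zero_of_mul hC'⟩

theorem forGeneral₂_of_eval_ne_zero [Infinite k] {P : (ι → k) → (κ → k) → Prop}
    {p : MvPolynomial ι k} {q : MvPolynomial κ k} (hp : p ≠ 0) (hq : q ≠ 0)
    (h : ∀ C C', eval C p ≠ 0 → eval C' q ≠ 0 → P C C') : ForGeneral₂ P :=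
  ⟨_, _, isZariskiOpen_eval_ne_zero p, isZariskiDense_eval_ne_zero hp,
    isZariskiOpen_eval_ne_zero q, isZariskiDense_eval_ne_zero hq,
    fun C hC C' hC' => h C C' hC hC'⟩

theorem IsZariskiDense.nonempty {U : Set (ι → k)} (hU : IsZariskiDense U) : U.Nonempty :=
  (hU Set.univ ⟨{1}, by simp⟩ Set.univ_nonempty).left

/-- Dense open sets intersect, so two general properties share a point. Uniqueness of the type
follows from this. -/
theorem ForGeneral₂.exists_and {P Q : (ι → k) → (κ → k) → Prop} (hP : ForGeneral₂ P)
    (hQ : ForGeneral₂ Q) : ∃ C C', P C C' ∧ Q C C' := by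
  obtain ⟨U, U', -, hU, -, hU', hP⟩ := hP
  obtain ⟨V, V', hVo, hV, hVo', hV', hQ⟩ := hQ
  obtain ⟨C, hCU, hCV⟩ := hU V hVo hV.nonempty
  obtain ⟨C', hCU', hCV'⟩ := hU' V' hVo' hV'.nonempty
  exact ⟨C, C', hP C hCU C' hCU', hQ C hCV C' hCV'⟩

/-- A general `s × β` matrix has full rank. -/
theorem exists_rank_eq_min (k : Type*) [Field k] (s : ℕ) (β : Type*) [Fintype β] :
    ∃ p : MvPolynomial (Fin s × β) k, p ≠ 0 ∧ ∀ C, eval C p ≠ 0 →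
      (Matrix.of fun n J => C (n, J)).rank = min s (Fintype.card β) := by
  set m := min s (Fintype.card β)
  let u : Fin m ↪ Fin s := Fin.castLEEmb (min_le_left _ _)
  let v : Fin m ↪ β :=
    (Fin.castLEEmb (min_le_right _ _)).trans (Fintype.equivFin β).symm.toEmbedding
  -- The nonvanishing condition is one maximal minor of the generic matrix, chosen by the embeddings
  -- `u` and `v`.
  refine ⟨rename (Prod.map u v) (Matrix.mvPolynomialX (Fin m) (Fin m) k).det, ?_, fun C hC => ?_⟩
  · rw [Ne, map_eq_zero_iff _ (rename_injective _ (u.injective.prodMap v.injective))]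
    exact Matrix.det_mvPolynomialX_ne_zero _ _
  · set A : Matrix (Fin s) β k := Matrix.of fun n J => C (n, J) with hA
    have hdet : eval C (rename (Prod.map u v) (Matrix.mvPolynomialX (Fin m) (Fin m) k).det) =
        (A.submatrix u v).det := by
      rw [eval_rename, RingHom.map_det]
      congr 1
      exact Matrix.mvPolynomialX_mapMatrix_eval (A.submatrix u v)
    rw [hdet] at hC
    refine le_antisymm (le_min (A.rank_le_card_height.trans_eq (Fintype.card_fin s))
      A.rank_le_card_width) ?_
    have h := Matrix.rank_of_isUnit (A.submatrix u v)
      ((Matrix.isUnit_iff_isUnit_det _).2 hC.isUnit)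
    rw [Fintype.card_fin] at h
    exact h.symm.trans_le (Matrix.rank_submatrix_le A u v)

end Zariski

/-! ### Spans of constrained forms and nondegenerate forms. -/

section formSpan

variable {k : Type*} [Field k] {r : ℕ} {K : List ℕ} {j s : ℕ}

/-- The form with given coefficients at the constrained monomials of degree `j`. -/
noncomputable def constrainedForm (k : Type*) [Field k] (r : ℕ) (K : List ℕ) (j : ℕ) :
    (constrained r K j → k) →ₗ[k] MvPolynomial (Fin r) k :=
  ∑ J : constrained r K j, monomial J.1 ∘ₗ LinearMap.proj J

theorem constrainedForm_apply (v : constrained r K j → k) :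
    constrainedForm k r K j v = ∑ J : constrained r K j, monomial J.1 (v J) := by
  simp [constrainedForm]

theorem coeff_constrainedForm (v : constrained r K j → k) (J : constrained r K j) :
    coeff J.1 (constrainedForm k r K j v) = v J := by
  rw [constrainedForm_apply, coeff_sum, Finset.sum_eq_single J]
  · rw [coeff_monomial, if_pos rfl]
  · intro J' _ h
    rw [coeff_monomial, if_neg fun h' => h (Subtype.ext h')]
  · intro h
    exact absurd (Finset.mem_univ J) h

theorem coeff_constrainedForm_of_notMem (v : constrained r K j → k) {D : Fin r →₀ ℕ}
    (hD : D ∉ constrained r K j) : coeff D (constrainedForm k r K j v) = 0 := by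
  rw [constrainedForm_apply, coeff_sum]
  refine Finset.sum_eq_zero fun J _ => ?_
  rw [coeff_monomial, if_neg]
  rintro rfl
  exact hD J.2

theorem constrainedForm_injective : Function.Injective (constrainedForm k r K j) := by
  intro v w h
  ext J
  rw [← coeff_constrainedForm v J, h, coeff_constrainedForm]

theorem degree_of_mem_constrained {D : Fin r →₀ ℕ} (hD : D ∈ constrained r K j) :
    D.degree = j := by
  rw [Finsupp.degree_eq_sum]
  exact (Finset.mem_finsuppAntidiag.1 (Finset.mem_filter.1 hD).1).1

theorem isHomogeneous_constrainedForm (v : constrained r K j → k) :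
    (constrainedForm k r K j v).IsHomogeneous j := by
  rw [constrainedForm_apply]
  exact IsHomogeneous.sum _ _ _ fun J _ =>
    isHomogeneous_monomial _ (degree_of_mem_constrained J.2)

theorem map_genericForm (C : Fin s × constrained r K j → k) (n : Fin s) :
    MvPolynomial.map (eval C) (genericForm k r K j s n) =
      constrainedForm k r K j fun J => C (n, J) := by
  simp [genericForm, constrainedForm_apply, map_monomial]

theorem formSpan_eq_map (C : Fin s × constrained r K j → k) :
    formSpan r K j s C = (Submodule.span k (Set.range
      (Matrix.of fun n J => C (n, J)).row)).map (constrainedForm k r K j) := by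
  rw [Submodule.map_span, ← Set.range_comp]
  unfold formSpan
  congr 2
  ext1 n
  exact map_genericForm C n

theorem formSpan_one (C : Fin 1 × constrained r K j → k) :
    formSpan r K j 1 C = k ∙ constrainedForm k r K j fun J => C (0, J) := by
  unfold formSpan
  rw [Set.range_unique]
  congr 2
  exact map_genericForm C _

theorem finrank_formSpan (C : Fin s × constrained r K j → k) :
    Module.finrank k (formSpan r K j s C) = (Matrix.of fun n J => C (n, J)).rank := by
  rw [Matrix.rank_eq_finrank_span_row, formSpan_eq_map]
  exact (Submodule.equivMapOfInjective _ constrainedForm_injective _).symm.finrank_eq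

theorem formSpan_le_range (C : Fin s × constrained r K j → k) :
    formSpan r K j s C ≤ LinearMap.range (constrainedForm k r K j) := by
  rw [formSpan_eq_map]
  exact LinearMap.map_le_range

theorem formSpan_le_homogeneousSubmodule (C : Fin s × constrained r K j → k) :
    formSpan r K j s C ≤ homogeneousSubmodule (Fin r) k j := by
  refine (formSpan_le_range C).trans ?_
  rintro _ ⟨v, rfl⟩
  exact isHomogeneous_constrainedForm v

instance finite_formSpan (C : Fin s × constrained r K j → k) :
    Module.Finite k (formSpan r K j s C) :=
  Module.Finite.span_of_finite k (Set.finite_range _)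

/-- A general form of degree `j ≥ 2` contains the power `x_m^j` and is annihilated by no nonzero
linear form. -/
theorem exists_nondegenerate [CharZero k] (hj : 2 ≤ j) (m₀ : Fin r)
    (hK : ∀ D : Fin r →₀ ℕ, D.degree = j → D ∈ constrained r K j) :
    ∃ q : MvPolynomial (Fin 1 × constrained r K j) k, q ≠ 0 ∧ ∀ C, eval C q ≠ 0 →
      coeff (Finsupp.single m₀ j) (constrainedForm k r K j fun J => C (0, J)) ≠ 0 ∧
      ∀ L : MvPolynomial (Fin r) k, L.IsHomogeneous 1 →
        diffAct k L (constrainedForm k r K j fun J => C (0, J)) = 0 → L = 0 := by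
  classical
  let u : Fin r → Fin r → constrained r K j := fun m n =>
    ⟨Finsupp.single m (j - 1) + Finsupp.single n 1, hK _ (by
      rw [map_add, Finsupp.degree_single, Finsupp.degree_single]; omega)⟩
  let w : Fin r → constrained r K j := fun m => ⟨Finsupp.single m j, hK _ (by simp)⟩
  -- `B m n` is the coefficient of `x_m^(j-1)` in `∂g/∂x_n` for the generic form `g`. If `det B ≠
  -- 0`, the partials of `g` are linearly independent.
  let B : Matrix (Fin r) (Fin r) (MvPolynomial (Fin 1 × constrained r K j) k) :=
    Matrix.of fun m n =>
      X (0, u m n) * MvPolynomial.C (((Finsupp.single m (j - 1) : Fin r →₀ ℕ) n : k) + 1)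
  have hBapply : ∀ m n, B m n = X (0, u m n) *
      MvPolynomial.C (((Finsupp.single m (j - 1) : Fin r →₀ ℕ) n : k) + 1) := fun _ _ => rfl
  refine ⟨B.det * X (0, w m₀), mul_ne_zero ?_ (X_ne_zero _), fun C hC => ?_⟩
  -- The Fermat form `∑ x_m^j` witnesses `det B ≠ 0`: there `B` becomes `j` times the identity,
  -- because `x_m^(j-1) x_n` with `m ≠ n` is not a pure power when `j ≥ 2`.
  · let C₀ : Fin 1 × constrained r K j → k := fun p => if ∃ m, p.2 = w m then 1 else 0
    have hB : (eval C₀).mapMatrix B = Matrix.diagonal fun _ => (j : k) := by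
      ext m n
      rw [RingHom.mapMatrix_apply, Matrix.map_apply, hBapply, map_mul, eval_X, eval_C]
      by_cases hmn : m = n
      · subst hmn
        have hu : ∃ m', u m m = w m' := ⟨m, Subtype.ext (by
          change Finsupp.single m (j - 1) + Finsupp.single m 1 = Finsupp.single m j
          rw [← Finsupp.single_add, Nat.sub_add_cancel (by omega)])⟩
        rw [Matrix.diagonal_apply_eq, Finsupp.single_eq_same, ← Nat.cast_add_one,
          Nat.sub_add_cancel (by omega)]
        simp only [C₀]
        rw [if_pos hu, one_mul]
      · have hu : ¬ ∃ m', u m n = w m' := by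
          rintro ⟨m', h⟩
          have h' : Finsupp.single m (j - 1) + Finsupp.single n 1 = Finsupp.single m' j :=
            congrArg Subtype.val h
          have h1 := DFunLike.congr_fun h' m
          have h2 := DFunLike.congr_fun h' n
          simp only [Finsupp.add_apply, Finsupp.single_apply] at h1 h2
          split_ifs at h1 h2 <;> omega
        rw [Matrix.diagonal_apply_ne _ hmn]
        simp only [C₀]
        rw [if_neg hu, zero_mul]
    intro h0
    have h := congrArg (eval C₀) h0
    rw [RingHom.map_det, hB, Matrix.det_diagonal, map_zero] at h
    exact Finset.prod_ne_zero_iff.2 (fun _ _ => Nat.cast_ne_zero.2 (by omega)) h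
  · rw [map_mul, eval_X] at hC
    refine ⟨?_, fun L hL hLg => ?_⟩
    · have h := coeff_constrainedForm (fun J => C (0, J)) (w m₀)
      exact h ▸ right_ne_zero_of_mul hC
    · rw [← mem_homogeneousSubmodule, homogeneousSubmodule_one_eq_span_X,
        Submodule.mem_span_range_iff_exists_fun] at hL
      obtain ⟨c, rfl⟩ := hL
      have hdet := left_ne_zero_of_mul hC
      rw [RingHom.map_det] at hdet
      have hc : c = 0 := by
        refine Matrix.eq_zero_of_mulVec_eq_zero hdet ?_
        ext m
        have h := congrArg (coeff (Finsupp.single m (j - 1))) hLg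
        rw [map_sum, LinearMap.sum_apply, coeff_sum, coeff_zero] at h
        rw [Matrix.mulVec, dotProduct, Pi.zero_apply, ← h]
        refine Finset.sum_congr rfl fun n _ => ?_
        rw [map_smul, LinearMap.smul_apply, coeff_smul, coeff_diffAct_X, smul_eq_mul,
          coeff_constrainedForm _ (u m n), RingHom.mapMatrix_apply, Matrix.map_apply,
          hBapply, map_mul, eval_X, eval_C]
        ring
      simp [hc]

end formSpan

/-! ### The type of the family. -/

/-- Permitted `s` has no upper bound, so the `s` general forms may outnumber the available
monomials; hence the minimum. -/
theorem F1HasType_of_F1Permitted {k : Type*} [Field k] [CharZero k] {a i s : ℕ}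
    (h : F1Permitted k a i s) :
    F1HasType k a i s (1 + min s (constrained 3 [a - 1] (i + a)).card) := by
  refine ⟨h, ?_⟩
  obtain ⟨ha, hi, -, -⟩ := h
  have hK : ∀ D : Fin 3 →₀ ℕ, D.degree = i + a →
      D ∈ constrained 3 [i + a, i + a, i + a] (i + a) := by
    intro D hD
    have hD' := hD
    rw [Finsupp.degree_eq_sum, Fin.sum_univ_three] at hD'
    refine Finset.mem_filter.2 ⟨Finset.mem_finsuppAntidiag.2 ⟨?_, Finset.subset_univ _⟩, ?_⟩
    · rw [← hD, Finsupp.degree_eq_sum]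
    · intro m hm
      fin_cases m <;> simp <;> omega
  obtain ⟨p, hp, hpC⟩ := exists_rank_eq_min k s (constrained 3 [a - 1] (i + a))
  obtain ⟨q, hq, hqC⟩ := exists_nondegenerate (k := k) (by omega : 2 ≤ i + a) 0 hK
  refine forGeneral₂_of_eval_ne_zero hp hq fun C C' hC hC' => ?_
  obtain ⟨hcoeff, hlin⟩ := hqC C' hC'
  have hrank := hpC C hC
  set E := formSpan 3 [a - 1] (i + a) s C with hE
  set G := formSpan 3 [i + a, i + a, i + a] (i + a) 1 C' with hG
  have hWhom : E ⊔ G ≤ homogeneousSubmodule (Fin 3) k (i + a) :=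
    sup_le (formSpan_le_homogeneousSubmodule C) (formSpan_le_homogeneousSubmodule C')
  set g := constrainedForm k 3 [i + a, i + a, i + a] (i + a) fun J => C' (0, J) with hg
  have hGg : G = k ∙ g := formSpan_one C'
  have hg0 : g ≠ 0 := by
    intro h0
    rw [h0] at hcoeff
    exact hcoeff (coeff_zero _)
  have hdisj : Disjoint E G := by
    -- If `g` lay in `ℰ(C)`, its coefficient at `x^j` would vanish, since the exponent `j` exceeds
    -- the bound `a - 1`.
    rw [hGg, Submodule.disjoint_span_singleton' hg0]
    intro hgE
    obtain ⟨v, hv⟩ := formSpan_le_range C hgE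
    rw [← hv] at hcoeff
    refine hcoeff (coeff_constrainedForm_of_notMem v fun hmem => ?_)
    have h0 := (Finset.mem_filter.1 hmem).2 0 (by simp)
    simp at h0
    omega
  have hrankW : Module.finrank k ↥(E ⊔ G) =
      1 + min s (constrained 3 [a - 1] (i + a)).card := by
    have hsum := Submodule.finrank_sup_add_finrank_inf_eq E G
    rw [hdisj.eq_bot, finrank_bot, add_zero, finrank_formSpan, hrank, hGg,
      finrank_span_singleton hg0, Fintype.card_coe] at hsum
    rw [hGg, hsum, add_comm]
  have hone : ∀ L ∈ annIdeal (E ⊔ G), L.IsHomogeneous 1 → L = 0 := fun L hL hL1 =>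
    hlin L hL1 (hL g (le_sup_right (a := E) (hGg ▸ Submodule.mem_span_singleton_self g)))
  rw [← hrankW]
  refine isLevelAlgebra_annIdeal hWhom (by rw [hrankW]; omega) fun d hd L hL hLd => ?_
  obtain rfl | rfl : d = 1 ∨ d = 0 := by omega
  · exact hone L hL hLd
  -- A constant in the ideal is multiplied by a variable to reduce to the linear case.
  · have hX := hone (L * X 0) (Ideal.mul_mem_right _ _ hL) (by
      simpa using hLd.mul (isHomogeneous_X k (0 : Fin 3)))
    exact (mul_eq_zero.1 hX).resolve_right (X_ne_zero _)

theorem F1HasType.eq {k : Type*} [Field k] [CharZero k] {a i s t : ℕ} (h : F1HasType k a i s t) :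
    t = 1 + min s (constrained 3 [a - 1] (i + a)).card := by
  obtain ⟨C, C', h1, h2⟩ := h.2.exists_and (F1HasType_of_F1Permitted h.1).2
  exact h1.type_eq.symm.trans h2.type_eq

/-! ### Bounds on the ceiling and minimal types. -/

/-- Here `2 #M(i+a) = a(2i+a+3)`, which is at least `a(2i+9-a)` for `a ≥ 3`, while `(a-1)(a-2) ≥ 2`.
-/
theorem ceil_le_card_constrained {a i : ℕ} (ha : 4 ≤ a) (hi : 2 * a ≤ i) :
    ⌈((a : ℚ) * (2 * i - a + 9)) / ((a : ℚ) ^ 2 - 3 * a + 2)⌉₊ ≤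
      (constrained 3 [a - 1] (i + a)).card := by
  rw [ceil_le_iff_rows ha hi]
  have h := two_mul_card_constrained_three (show a - 1 ≤ i + a + 1 by omega)
  obtain ⟨b, rfl⟩ : ∃ b, a = b + 4 := ⟨a - 4, by omega⟩
  obtain ⟨c, rfl⟩ : ∃ c, i = 2 * (b + 4) + c := ⟨i - 2 * (b + 4), by omega⟩
  have h1 : b + 4 - 1 = b + 3 := by omega
  have h2 : b + 4 - 2 = b + 2 := by omega
  have h3 : 2 * (2 * (b + 4) + c) + 9 - (b + 4) = 3 * b + 2 * c + 21 := by omega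
  have h4 : 2 * (2 * (b + 4) + c + (b + 4)) + 2 - (b + 3) = 5 * b + 2 * c + 23 := by omega
  rw [h1, h4] at h
  rw [h1, h2, h3]
  calc (b + 4) * (3 * b + 2 * c + 21) ≤
        2 * (constrained 3 [b + 3] (2 * (b + 4) + c + (b + 4))).card := by
        rw [h]
        exact Nat.mul_le_mul_left _ (by omega)
    _ ≤ _ := by
        rw [mul_comm]
        exact Nat.mul_le_mul_left _ (by nlinarith)

/-- For `i ≥ 2a` the numerator is at least `3a² + 9a`, which exceeds `3(a² - 3a + 2)`; the quotient
is therefore above `3`. -/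
theorem four_le_ceil {a i : ℕ} (ha : 4 ≤ a) (hi : 2 * a ≤ i) :
    4 ≤ ⌈((a : ℚ) * (2 * i - a + 9)) / ((a : ℚ) ^ 2 - 3 * a + 2)⌉₊ := by
  by_contra! hlt
  have h := (ceil_le_iff_rows ha hi).1 (Nat.lt_succ_iff.1 hlt)
  obtain ⟨b, rfl⟩ : ∃ b, a = b + 4 := ⟨a - 4, by omega⟩
  obtain ⟨c, rfl⟩ : ∃ c, i = 2 * (b + 4) + c := ⟨i - 2 * (b + 4), by omega⟩
  have h1 : b + 4 - 1 = b + 3 := by omega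
  have h2 : b + 4 - 2 = b + 2 := by omega
  have h3 : 2 * (2 * (b + 4) + c) + 9 - (b + 4) = 3 * b + 2 * c + 21 := by omega
  rw [h1, h2, h3] at h
  nlinarith

theorem ceil_mono {a i i' : ℕ} (ha : 4 ≤ a) (hi : 2 * a ≤ i) (h : i ≤ i') :
    ⌈((a : ℚ) * (2 * i - a + 9)) / ((a : ℚ) ^ 2 - 3 * a + 2)⌉₊ ≤
      ⌈((a : ℚ) * (2 * i' - a + 9)) / ((a : ℚ) ^ 2 - 3 * a + 2)⌉₊ := by
  rw [ceil_le_iff_rows ha hi]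
  exact (Nat.mul_le_mul_left _ (by omega)).trans ((ceil_le_iff_rows ha (hi.trans h)).1 le_rfl)

section minimalType

variable {k : Type*} [Field k]

theorem ceil_le_of_F1Permitted {a i s : ℕ} (h : F1Permitted k a i s) :
    ⌈((a : ℚ) * (2 * i - a + 9)) / ((a : ℚ) ^ 2 - 3 * a + 2)⌉₊ ≤ s := by
  obtain ⟨ha, hi, -, h⟩ := (F1Permitted_iff k a i s).1 h
  exact (ceil_le_iff_rows ha hi).2 h

/-- Both arguments of the minimum in the type are at least the ceiling. -/
theorem F1HasType.one_add_ceil_le [CharZero k] {a i s t : ℕ} (h : F1HasType k a i s t) :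
    1 + ⌈((a : ℚ) * (2 * i - a + 9)) / ((a : ℚ) ^ 2 - 3 * a + 2)⌉₊ ≤ t := by
  rw [h.eq]
  exact Nat.add_le_add_left (le_min (ceil_le_of_F1Permitted h.1)
    (ceil_le_card_constrained h.1.1 h.1.2.1)) 1

theorem F1HasType_ceil [CharZero k] {a i : ℕ} (ha : 4 ≤ a) (hi : 2 * a ≤ i) :
    F1HasType k a i ⌈((a : ℚ) * (2 * i - a + 9)) / ((a : ℚ) ^ 2 - 3 * a + 2)⌉₊
      (1 + ⌈((a : ℚ) * (2 * i - a + 9)) / ((a : ℚ) ^ 2 - 3 * a + 2)⌉₊) := by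
  have h := F1HasType_of_F1Permitted ((F1Permitted_iff k a i _).2 ⟨ha, hi,
    lt_of_lt_of_le (by norm_num) (four_le_ceil ha hi), (ceil_le_iff_rows ha hi).1 le_rfl⟩)
  rwa [min_eq_left (ceil_le_card_constrained ha hi)] at h

end minimalType

theorem mainTheorem9 (k : Type*) [Field k] [IsAlgClosed k] [CharZero k] :
    -- (i)
    (∀ a i s : ℕ, 4 ≤ a → 2 * a ≤ i →
      s = ⌈((a : ℚ) * (2 * i - a + 9)) / ((a : ℚ) ^ 2 - 3 * a + 2)⌉₊ →
        F1HasType k a i s (1 + s) ∧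
        IsLeast {t : ℕ | ∃ s' : ℕ, F1HasType k a i s' t} (1 + s)) ∧
    -- (ii)
    (∀ a s : ℕ, 4 ≤ a →
      s = ⌈((a : ℚ) * (3 * a + 9)) / ((a : ℚ) ^ 2 - 3 * a + 2)⌉₊ →
        F1HasType k a (2 * a) s (1 + s) ∧
        IsLeast {t : ℕ | ∃ i s' : ℕ, F1HasType k a i s' t} (1 + s) ∧
        (a ≤ 20 → 5 < 1 + s) ∧ (21 ≤ a → 1 + s = 5)) ∧
    -- (iii)
    (∀ a i s : ℕ, F1Permitted k a i s →
      (∃! t : ℕ, F1HasType k a i s t) ∧ ∀ t : ℕ, F1HasType k a i s t → 5 ≤ t) := by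
  refine ⟨?_, ?_, ?_⟩
  · rintro a i s ha hi rfl
    refine ⟨F1HasType_ceil ha hi, ⟨_, F1HasType_ceil ha hi⟩, ?_⟩
    rintro t ⟨s', h⟩
    exact h.one_add_ceil_le
  · intro a s ha hs
    have hs' : s = ⌈((a : ℚ) * (2 * (2 * a : ℕ) - a + 9)) / ((a : ℚ) ^ 2 - 3 * a + 2)⌉₊ := by
      rw [hs]
      push_cast
      congr 3
      ring
    have h4 : 4 ≤ s := hs' ▸ four_le_ceil ha le_rfl
    -- The right-hand side amounts to `a² - 21a + 8 ≥ 0`, which fails for `4 ≤ a ≤ 20` and holds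
    -- from `a = 21` on.
    have hle : s ≤ 4 ↔ a * (2 * (2 * a) + 9 - a) ≤ 4 * ((a - 1) * (a - 2)) :=
      hs' ▸ ceil_le_iff_rows ha le_rfl
    refine ⟨hs' ▸ F1HasType_ceil ha le_rfl, ⟨⟨2 * a, s, hs' ▸ F1HasType_ceil ha le_rfl⟩, ?_⟩,
      fun h20 => ?_, fun h21 => ?_⟩
    · rintro t ⟨i, s', h⟩
      rw [hs']
      exact (Nat.add_le_add_left (ceil_mono ha le_rfl h.1.2.1) 1).trans h.one_add_ceil_le
    · by_contra! hlt
      have h := hle.1 (by omega)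
      clear hle hs hs' h4
      interval_cases a <;> omega
    · have : s ≤ 4 := by
        rw [hle]
        obtain ⟨b, rfl⟩ : ∃ b, a = b + 21 := ⟨a - 21, by omega⟩
        have h1 : b + 21 - 1 = b + 20 := by omega
        have h2 : b + 21 - 2 = b + 19 := by omega
        have h3 : 2 * (2 * (b + 21)) + 9 - (b + 21) = 3 * b + 72 := by omega
        rw [h1, h2, h3]
        nlinarith
      omega
  · intro a i s h
    refine ⟨⟨_, F1HasType_of_F1Permitted h, fun t ht => ht.eq⟩, fun t ht => ?_⟩
    exact (Nat.add_le_add_left (four_le_ceil h.1 h.2.1) 1).trans ht.one_add_ceil_le
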